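/- Let $(Q,g)$ be a smooth $n$-dimensional semi-Riemannian manifold and $T^*Q$ its cotangent bundle with canonical coordinates $(q^i,p_i)$ (induced by charts of $Q$) and symplectic form $\omega=\sum_j dp_j\wedge dq^j$. Let $\tilde\Gamma^k_{ij}$ be the Christoffel symbols of the Levi-Civita connection of $g$, and let $\nabla$ be the lifted torsion-free symplectic connection on $T^*Q$ with coefficients, writing $i$ for $q^i$ and $\bar i$ for $p_i$ as indices, $$\Gamma^{k}_{ij}=-\Gamma^{\bar j}_{i\bar k}=-\Gamma^{\bar i}_{\bar k j}=\tilde\Gamma^k_{ij},\qquad \Gamma^{\bar k}_{ij}=\tfrac13\sum_a p_a\Big(\sum_l 2\tilde\Gamma^a_{jl}\tilde\Gamma^l_{ki}-\partial_j\tilde\Gamma^a_{ki}+\text{cycl.}(ijk)\Big),$$ all other coefficients being zero. Let $R$ be its curvature, with $R^i{}_{jkl}=\partial_k\Gamma^i_{lj}-\partial_l\Gamma^i_{kj}+\Gamma^i_{km}\Gamma^m_{lj}-\Gamma^i_{lm}\Gamma^m_{kj}$ and $R_{ijkl}=\omega_{im}R^m{}_{jkl}$. Let $\mathcal W$ be the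 formal Weyl bundle, whose sections are the formal series $\sum_{k,\alpha}\hbar^k f_{k,\alpha}\,y^\alpha$ with $f_{k,\alpha}$ smooth complex functions and $y^\mu$ the fibre generators dual to $\partial_\mu$, with the product $$a\circ b=\sum_{t\ge0}\frac{1}{t!}\Big(\frac{i\hbar}2\Big)^t\omega^{\mu_1\nu_1}\cdots\omega^{\mu_t\nu_t}\,(\partial_{y^{\mu_1}}\cdots\partial_{y^{\mu_t}}a)(\partial_{y^{\nu_1}}\cdots\partial_{y^{\nu_t}}b),$$ where $(\omega^{\mu\nu})$ is the inverse matrix of $(\omega_{\mu\nu})$; extend $\circ$ to $\mathcal W$-valued differential forms and $\nabla$ to an exterior covariant derivative on them. Put $\delta=dx^\mu\wedge\partial/\partial y^\mu$, and let $\delta^{-1}=\frac1{l+p}\,y^\mu\,\iota(\partial/\partial x^\mu)$ on $p$-forms of degree $l$ in the $y$'s ($\delta^{-1}=0$ if $l+p=0$). Let $\hat R=-\frac14R_{ijkl}y^iy^jdx^k\wedge dx^l$, and let the $\mathcal W$-valued 1-form $r$ be the limit of the iteration, started at $0$, $$r\mapsto\delta^{-1}\Big(\hat R+\nabla r+\frac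 i\hbar\,r\circ r\Big)$$ (Fedosov's solution of $\delta r=\hat R+\nabla r+\frac i\hbar r\circ r$, $\delta^{-1}r=0$). For $f\in C^\infty(T^*Q)$ let $\hat f$ be the limit of the iteration, started at $f$, $$a\mapsto f+\delta^{-1}\Big(\nabla a+\frac i\hbar[r,a]\Big)$$ (the flat section for $D=\nabla-\delta+\frac i\hbar[r,\cdot\,]$ with $y$-degree-zero part $f$). The Fedosov star product $f*h\in C^\infty(T^*Q)[[\hbar]]$ is the part of $\hat f\circ\hat h$ of degree $0$ in the $y$'s. Let $N,M\ge0$, and let $f,h\in C^\infty(T^*Q)$ be complex-valued functions, not depending on $\hbar$, whose restrictions to every cotangent space $T^*_xQ$ are polynomials of degree at most $N$ and $M$ respectively (with arbitrary smooth dependence on $q$). Then $f*h$ is a polynomial in $\hbar$ of degree at most $N+M$; that is, the coefficient of $\hbar^k$ in $f*h$ vanishes for every $k>N+M$. -/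

import Mathlib

open scoped Manifold ContDiff

noncomputable section

namespace Fedosov

/-! ### Formal Weyl algebra over the phase space `ℝ²ⁿ` -/

/-- Indices of canonical coordinates: `Sum.inl i` stands for `q^i`, `Sum.inr i` for `p_i`. -/
abbrev Idx (n : ℕ) : Type := Fin n ⊕ Fin n

/-- Coordinate phase space; a point `x` has `q^i = x (Sum.inl i)` and `p_i = x (Sum.inr i)`. -/
abbrev Phase (n : ℕ) : Type := Idx n → ℝ

/-- Sections of the formal Weyl bundle in canonical coordinates: formal series
`∑ ħ^k f_{k,α}(x) y^α`. The ring product of this type is the symmetric product. The outer power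
series variable is `ħ`, the inner variables are the generators `y^μ`. -/
abbrev Weyl (n : ℕ) : Type := PowerSeries (MvPowerSeries (Idx n) (Phase n → ℂ))

/-- The coefficient function of `ħ^k y^α`. -/
def Weyl.coeff {n : ℕ} (k : ℕ) (α : Idx n →₀ ℕ) (a : Weyl n) : Phase n → ℂ :=
  MvPowerSeries.coeff α (PowerSeries.coeff k a)

/-- The formal power series in the `y^μ` with prescribed coefficient functions. -/
def symSeries {n : ℕ} (c : (Idx n →₀ ℕ) → Phase n → ℂ) : MvPowerSeries (Idx n) (Phase n → ℂ) := c

/-- The section with prescribed coefficient functions. -/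
def Weyl.mk {n : ℕ} (c : ℕ → (Idx n →₀ ℕ) → Phase n → ℂ) : Weyl n :=
  PowerSeries.mk fun k => symSeries (c k)

theorem Weyl.coeff_mk {n : ℕ} (c : ℕ → (Idx n →₀ ℕ) → Phase n → ℂ) (k : ℕ) (α : Idx n →₀ ℕ) :
    (Weyl.mk c).coeff k α = c k α := by
  unfold Weyl.mk Weyl.coeff
  rw [PowerSeries.coeff_mk]
  rfl

/-- A function on phase space, as a section of the Weyl bundle. -/
def Weyl.ofFun {n : ℕ} (f : Phase n → ℂ) : Weyl n := PowerSeries.C (MvPowerSeries.C f)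

/-- A real function on phase space, as a section of the Weyl bundle. -/
def Weyl.ofReal {n : ℕ} (f : Phase n → ℝ) : Weyl n := Weyl.ofFun fun x => (f x : ℂ)

/-- The generator `y^μ`. -/
def Weyl.y {n : ℕ} (μ : Idx n) : Weyl n := PowerSeries.C (MvPowerSeries.X μ)

/-- The fibre derivative `∂/∂y^μ`. -/
def Weyl.dy {n : ℕ} (μ : Idx n) (a : Weyl n) : Weyl n :=
  PowerSeries.mk fun k => MvPowerSeries.pderiv (Phase n → ℂ) μ (PowerSeries.coeff k a)

/-- Partial derivative in the direction of the `i`-th coordinate. -/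
def partialDeriv {ι : Type} [Fintype ι] [DecidableEq ι] {F : Type} [NormedAddCommGroup F]
    [NormedSpace ℝ F] (i : ι) (f : (ι → ℝ) → F) (x : ι → ℝ) : F :=
  fderiv ℝ f x (Pi.single i 1)

/-- The derivative `∂/∂x^μ` of all coefficient functions. -/
def Weyl.dx {n : ℕ} (μ : Idx n) (a : Weyl n) : Weyl n :=
  Weyl.mk fun k α => partialDeriv μ (a.coeff k α)

/-- The components `ω_{μν}` of `ω = ∑ dp_j ∧ dq^j`, i.e. `ω(∂_{p_j}, ∂_{q^j}) = 1`. -/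
def omega (n : ℕ) : Matrix (Idx n) (Idx n) ℝ := Matrix.J (Fin n) ℝ

/-- The components `ω^{μν}` of the inverse of `ω`, so that `{q^j, p_j} = ω^{q^j p_j} = 1`. -/
def omegaInv (n : ℕ) : Matrix (Idx n) (Idx n) ℝ := (omega n)⁻¹

/-- `ω^{μ₁ν₁} ⋯ ω^{μ_tν_t} (∂_{y^{μ₁}} ⋯ ∂_{y^{μ_t}} a) (∂_{y^{ν₁}} ⋯ ∂_{y^{ν_t}} b)`. -/
def Weyl.contract {n : ℕ} : ℕ → Weyl n → Weyl n → Weyl n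
  | 0, a, b => a * b
  | t + 1, a, b => ∑ μ, ∑ ν,
      (omegaInv n μ ν : ℂ) • Weyl.contract t (Weyl.dy μ a) (Weyl.dy ν b)

/-- The Weyl product `a ∘ b = ∑_t (iħ/2)^t / t! · contract t a b`; it satisfies
`y^μ ∘ y^ν = y^μ y^ν + (iħ/2) ω^{μν}`. -/
def Weyl.prod {n : ℕ} (a b : Weyl n) : Weyl n :=
  Weyl.mk fun k α => ∑ t ∈ Finset.range (k + 1),
    ((Complex.I / 2) ^ t / (t.factorial : ℂ)) • (Weyl.contract t a b).coeff (k - t) α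

/-- The commutator `[a, b]` for the Weyl product. -/
def Weyl.comm {n : ℕ} (a b : Weyl n) : Weyl n := Weyl.prod a b - Weyl.prod b a

/-- Multiplication by `i/ħ`, applied below only to commutators, which are divisible by `ħ`. -/
def Weyl.iOverHbar {n : ℕ} (a : Weyl n) : Weyl n :=
  Weyl.mk fun k α => Complex.I • a.coeff (k + 1) α

/-- Multiplication of the part of symmetric degree `l` (in the `y^μ`) by `c l`. -/
def Weyl.scale {n : ℕ} (c : ℕ → ℂ) (a : Weyl n) : Weyl n :=
  Weyl.mk fun k α => c α.degree • a.coeff k α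

/-! ### Weyl-algebra-valued forms

A 1-form is given by its components `η_μ = η(∂_μ)`, a 2-form by its components
`θ_{μν} = θ(∂_μ, ∂_ν)`, antisymmetric in `μ, ν`. -/

/-- Covariant derivative of a 0-form,
`(∇a)_ν = ∂_ν a - Γ^i_{cν} y^c ∂a/∂y^i`, with `Γ i j k` denoting `Γ^i_{jk}`. -/
def nabla {n : ℕ} (Γ : Idx n → Idx n → Idx n → Phase n → ℝ) (a : Weyl n) (ν : Idx n) : Weyl n :=
  Weyl.dx ν a - ∑ i, ∑ c, Weyl.ofReal (Γ i c ν) * Weyl.y c * Weyl.dy i a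

/-- Exterior covariant derivative of a 1-form. -/
def nablaOne {n : ℕ} (Γ : Idx n → Idx n → Idx n → Phase n → ℝ) (η : Idx n → Weyl n)
    (μ ν : Idx n) : Weyl n :=
  nabla Γ (η ν) μ - nabla Γ (η μ) ν

/-- `δ⁻¹ = (l + p)⁻¹ δ*` on 1-forms: `δ*η = y^μ η_μ`. On the part of symmetric degree `m` of
the result one has `l + p = m`. -/
def deltaInvOne {n : ℕ} (η : Idx n → Weyl n) : Weyl n :=
  Weyl.scale (fun m => (m : ℂ)⁻¹) (∑ μ, Weyl.y μ * η μ)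

/-- `δ⁻¹ = (l + p)⁻¹ δ*` on 2-forms: `(δ*θ)_ν = y^μ θ_{μν}`. On the part of symmetric degree `m`
of the result one has `l + p = m + 1`. -/
def deltaInvTwo {n : ℕ} (θ : Idx n → Idx n → Weyl n) (ν : Idx n) : Weyl n :=
  Weyl.scale (fun m => ((m : ℂ) + 1)⁻¹) (∑ μ, Weyl.y μ * θ μ ν)

/-- The curvature components `R^i_{jkl}` of a connection with coefficients `Γ^i_{jk}`. -/
def curvature {n : ℕ} (Γ : Idx n → Idx n → Idx n → Phase n → ℝ) (i j k l : Idx n)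
    (x : Phase n) : ℝ :=
  partialDeriv k (Γ i l j) x - partialDeriv l (Γ i k j) x
    + ∑ m, (Γ i k m x * Γ m l j x - Γ i l m x * Γ m k j x)

/-- The components `-½ R_{ijkl} y^i y^j`, `R_{ijkl} = ω_{im} R^m_{jkl}`, of the 2-form
`R̂ = -¼ R_{ijkl} y^i y^j dx^k ∧ dx^l`. -/
def curvatureHat {n : ℕ} (Γ : Idx n → Idx n → Idx n → Phase n → ℝ) (k l : Idx n) : Weyl n :=
  ∑ i, ∑ j, Weyl.ofReal (fun x => -(1 / 2) * ∑ m, omega n i m * curvature Γ m j k l x)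
    * Weyl.y i * Weyl.y j

/-- The limit of a sequence of sections in which the terms `ħ^k y^α`, of `ħ`-degree
`k + |α|/2`, do not change any more from the index `2k + |α|` on. -/
def Weyl.lim {n : ℕ} (s : ℕ → Weyl n) : Weyl n :=
  Weyl.mk fun k α => (s (2 * k + α.degree)).coeff k α

/-- The iteration `r ↦ δ⁻¹ (R̂ + ∇ r + (i/ħ) r²)`; note `(r²)(∂_μ, ∂_ν) = [r_μ, r_ν]`. -/
def formIter {n : ℕ} (Γ : Idx n → Idx n → Idx n → Phase n → ℝ) : ℕ → Idx n → Weyl n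
  | 0 => 0
  | m + 1 => deltaInvTwo fun μ ν => curvatureHat Γ μ ν + nablaOne Γ (formIter Γ m) μ ν
      + Weyl.iOverHbar (Weyl.comm (formIter Γ m μ) (formIter Γ m ν))

/-- The 1-form `r` in Fedosov's flat connection `D = ∇ - δ + (i/ħ)[r, ·]`: the solution of
`δ r = R̂ + ∇ r + (i/ħ) r²`, `δ⁻¹ r = 0`, obtained as the limit of the iteration. -/
def fedosovForm {n : ℕ} (Γ : Idx n → Idx n → Idx n → Phase n → ℝ) (μ : Idx n) : Weyl n :=
  Weyl.lim fun m => formIter Γ m μ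

/-- The iteration `a ↦ f + δ⁻¹ (∇ a + (i/ħ) [r, a])`. -/
def liftIter {n : ℕ} (Γ : Idx n → Idx n → Idx n → Phase n → ℝ) (f : Phase n → ℂ) : ℕ → Weyl n
  | 0 => Weyl.ofFun f
  | m + 1 => Weyl.ofFun f + deltaInvOne fun μ => nabla Γ (liftIter Γ f m) μ
      + Weyl.iOverHbar (Weyl.comm (fedosovForm Γ μ) (liftIter Γ f m))

/-- The flat section `f̂`, `D f̂ = 0`, with `f̂₀ = f`, obtained as the limit of the iteration. -/
def flatLift {n : ℕ} (Γ : Idx n → Idx n → Idx n → Phase n → ℝ) (f : Phase n → ℂ) : Weyl n :=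
  Weyl.lim (liftIter Γ f)

/-- Fedosov's star product in canonical coordinates: the part of `f̂ ∘ ĝ` of symmetric degree
zero, a formal power series in `ħ`. -/
def coordStar {n : ℕ} (Γ : Idx n → Idx n → Idx n → Phase n → ℝ) (f g : Phase n → ℂ) :
    PowerSeries (Phase n → ℂ) :=
  PowerSeries.mk fun k => (Weyl.prod (flatLift Γ f) (flatLift Γ g)).coeff k 0

/-! ### The lifted Levi-Civita connection in coordinates -/

/-- Christoffel symbols `Γ^k_{ij}` of a metric with coefficient matrix `G`. -/
def christoffel {n : ℕ} (G : (Fin n → ℝ) → Matrix (Fin n) (Fin n) ℝ) (k i j : Fin n)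
    (q : Fin n → ℝ) : ℝ :=
  1 / 2 * ∑ l, (G q)⁻¹ k l * (partialDeriv i (fun q => G q j l) q
    + partialDeriv j (fun q => G q i l) q - partialDeriv l (fun q => G q i j) q)

/-- `2 Γ^a_{jl} Γ^l_{ki} - ∂_j Γ^a_{ki}`. -/
def liftTerm {n : ℕ} (C : Fin n → Fin n → Fin n → (Fin n → ℝ) → ℝ) (a i j k : Fin n)
    (q : Fin n → ℝ) : ℝ :=
  2 * ∑ l, C a j l q * C l k i q - partialDeriv j (C a k i) q

/-- Coefficients `Γ^λ_{μν}` of the canonical symplectic lift to phase space of the torsion-free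
connection with Christoffel symbols `C`:
`Γ^{q^k}_{q^i q^j} = -Γ^{p_j}_{q^i p_k} = -Γ^{p_i}_{p_k q^j} = C^k_{ij}`,
`Γ^{p_k}_{q^i q^j} = (p_a / 3) (2 C^a_{jl} C^l_{ki} - ∂_j C^a_{ki} + cyclic in (i, j, k))`,
all others zero. -/
def liftedConnection {n : ℕ} (C : Fin n → Fin n → Fin n → (Fin n → ℝ) → ℝ) :
    Idx n → Idx n → Idx n → Phase n → ℝ
  | .inl k, .inl i, .inl j => fun x => C k i j (x ∘ Sum.inl)
  | .inr j, .inl i, .inr k => fun x => -C k i j (x ∘ Sum.inl)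
  | .inr i, .inr k, .inl j => fun x => -C k i j (x ∘ Sum.inl)
  | .inr k, .inl i, .inl j => fun x => ∑ a, x (Sum.inr a) / 3 *
      (liftTerm C a i j k (x ∘ Sum.inl) + liftTerm C a j k i (x ∘ Sum.inl)
        + liftTerm C a k i j (x ∘ Sum.inl))
  | _, _, _ => fun _ => 0

/-! ### Semi-Riemannian manifolds and their cotangent bundles -/

/-- A smooth semi-Riemannian metric: a smooth field of nondegenerate symmetric bilinear forms. -/
structure SemiRiemannianMetric (n : ℕ) (Q : Type*) [TopologicalSpace Q]
    [ChartedSpace (EuclideanSpace ℝ (Fin n)) Q] [IsManifold (𝓡 n) ∞ Q] where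
  inner (x : Q) : TangentSpace (𝓡 n) x →L[ℝ] TangentSpace (𝓡 n) x →L[ℝ] ℝ
  symm (x : Q) (v w : TangentSpace (𝓡 n) x) : inner x v w = inner x w v
  nondegenerate (x : Q) (v : TangentSpace (𝓡 n) x) (hv : ∀ w, inner x v w = 0) : v = 0
  contMDiff : ContMDiff (𝓡 n)
    ((𝓡 n).prod 𝓘(ℝ, EuclideanSpace ℝ (Fin n) →L[ℝ] EuclideanSpace ℝ (Fin n) →L[ℝ] ℝ)) ∞
    fun x => Bundle.TotalSpace.mk'
      (EuclideanSpace ℝ (Fin n) →L[ℝ] EuclideanSpace ℝ (Fin n) →L[ℝ] ℝ)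
      (E := fun x : Q => TangentSpace (𝓡 n) x →L[ℝ] TangentSpace (𝓡 n) x →L[ℝ] ℝ) x (inner x)

/-- The cotangent bundle `T*Q`, with Mathlib's topology and smooth structure on the bundle of
continuous linear maps from the tangent bundle to the trivial line bundle. -/
abbrev CotangentBundle (n : ℕ) (Q : Type*) [TopologicalSpace Q]
    [ChartedSpace (EuclideanSpace ℝ (Fin n)) Q] : Type _ :=
  Bundle.TotalSpace (EuclideanSpace ℝ (Fin n) →L[ℝ] ℝ)
    fun x : Q => TangentSpace (𝓡 n) x →L[ℝ] Bundle.Trivial Q ℝ x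

section Manifold

variable {n : ℕ} {Q : Type*} [TopologicalSpace Q] [ChartedSpace (EuclideanSpace ℝ (Fin n)) Q]

/-- A smooth complex-valued function on `T*Q`. -/
def SmoothOnCotangent [IsManifold (𝓡 n) ∞ Q] (f : CotangentBundle n Q → ℂ) : Prop :=
  ContMDiff ((𝓡 n).prod 𝓘(ℝ, EuclideanSpace ℝ (Fin n) →L[ℝ] ℝ)) 𝓘(ℝ, ℂ) ∞ f

/-- `f` restricts to a polynomial of degree at most `N` on every cotangent space. -/
def IsMomentumPolynomial (N : ℕ) (f : CotangentBundle n Q → ℂ) : Prop :=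
  ∀ x : Q, ∃ P : MvPolynomial (Fin n) ℂ, P.totalDegree ≤ N ∧
    ∀ ξ : TangentSpace (𝓡 n) x →L[ℝ] ℝ,
      f ⟨x, ξ⟩ = MvPolynomial.eval
        (fun i => ((ξ (EuclideanSpace.single i 1 : EuclideanSpace ℝ (Fin n)) : ℝ) : ℂ)) P

/-- The coordinate vector `∂/∂q^i` of the chart `φ` at the point with coordinates `q`. -/
def coordVector (φ : OpenPartialHomeomorph Q (EuclideanSpace ℝ (Fin n)))
    (q : EuclideanSpace ℝ (Fin n)) (i : Fin n) : TangentSpace (𝓡 n) (φ.symm q) :=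
  mfderiv (𝓡 n) (𝓡 n) φ.symm q (EuclideanSpace.single i 1 : EuclideanSpace ℝ (Fin n))

/-- Canonical coordinates `(q, p)` on `T*Q` induced by the chart `φ` of `Q`. -/
def canonicalCoords (φ : OpenPartialHomeomorph Q (EuclideanSpace ℝ (Fin n)))
    (m : CotangentBundle n Q) : Phase n :=
  Sum.elim (fun i => φ m.proj i) fun i =>
    m.snd (mfderiv (𝓡 n) (𝓡 n) φ.symm (φ m.proj)
      (EuclideanSpace.single i 1 : EuclideanSpace ℝ (Fin n)))

/-- The covector `∑ p_i dq^i` at the point with coordinates `q`. -/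
def ofCanonicalCoords (φ : OpenPartialHomeomorph Q (EuclideanSpace ℝ (Fin n)))
    (x : Phase n) : CotangentBundle n Q :=
  ⟨φ.symm (WithLp.toLp 2 (x ∘ Sum.inl)),
    ((∑ i, x (Sum.inr i) • EuclideanSpace.proj i : EuclideanSpace ℝ (Fin n) →L[ℝ] ℝ).comp
      (mfderiv (𝓡 n) (𝓡 n) φ (φ.symm (WithLp.toLp 2 (x ∘ Sum.inl)))))⟩

variable [IsManifold (𝓡 n) ∞ Q]

/-- The metric coefficients `g_{ij}(q)` in the chart `φ`. -/
def metricCoeff (g : SemiRiemannianMetric n Q)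
    (φ : OpenPartialHomeomorph Q (EuclideanSpace ℝ (Fin n))) (q : Fin n → ℝ) :
    Matrix (Fin n) (Fin n) ℝ :=
  Matrix.of fun i j => g.inner (φ.symm (WithLp.toLp 2 q))
    (coordVector φ (WithLp.toLp 2 q) i) (coordVector φ (WithLp.toLp 2 q) j)

/-- The Fedosov star product on `T*Q` of the lifted Levi-Civita connection, over the domain of
the chart `φ`, computed in the canonical coordinates induced by `φ`. -/
def chartStar (g : SemiRiemannianMetric n Q)
    (φ : OpenPartialHomeomorph Q (EuclideanSpace ℝ (Fin n))) (f h : CotangentBundle n Q → ℂ) :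
    PowerSeries (CotangentBundle n Q → ℂ) :=
  PowerSeries.mk fun k m => PowerSeries.coeff k
    (coordStar (liftedConnection (christoffel (metricCoeff g φ)))
      (f ∘ ofCanonicalCoords φ) (h ∘ ofCanonicalCoords φ)) (canonicalCoords φ m)

/-- The Fedosov star product on `T*Q` of the lifted Levi-Civita connection. -/
def fedosovStar (g : SemiRiemannianMetric n Q) (f h : CotangentBundle n Q → ℂ) :
    PowerSeries (CotangentBundle n Q → ℂ) :=
  PowerSeries.mk fun k m => PowerSeries.coeff k
    (chartStar g (chartAt (EuclideanSpace ℝ (Fin n)) m.proj) f h) m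

end Manifold

end Fedosov

end

/-!
The bound is a matter of homogeneity. Give `p_i`, `y^{p_i}`, `dp_i` and `ħ` weight one, and `q^i`,
`y^{q^i}`, `dq^i` weight zero; "weight at most `w`" then means that the coefficient of
`ħ^k y^α` is a polynomial in the momenta of degree at most `w - k - |α_p|`, which is zero when that
number is negative (`HasWeight`). Everything in Fedosov's construction respects this filtration:

* a contraction with the Poisson tensor pairs a position with a momentum and lowers the weight by
  one, while it is accompanied by one factor `ħ`, so weights add up under the Weyl product
  (`HasWeight.prod`); `i/ħ` lowers the weight by one;
* the lifted Levi-Civita connection has weight zero (`isWeightZero_liftedConnection`), hence `∇`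
  preserves the weight, as do `δ` and `δ⁻¹`, and its curvature form `R̂` has weight one;
* by induction along the iterations, the one-form `r` has weight one
  (`hasWeight_fedosovForm`), and the flat lift of a function of degree at most `N` in the momenta
  has weight at most `N` (`hasWeight_flatLift`).

Hence `f̂ ∘ ĥ` has weight at most `N + M`, and the coefficient of `ħ^k y^0` vanishes for
`k > N + M`.

Being a polynomial in the momenta with smooth coefficients is expressed by the vanishing of
iterated derivatives in the momenta (`IsPol`): stability under derivatives in the positions is then
the symmetry of second derivatives, and no coefficients have to be extracted. All statements are
local, over the domain of a chart, where the metric coefficients are smooth and nondegenerate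
(`contDiffOn_metricCoeff`, `det_metricCoeff_ne_zero`) and canonical coordinates are smooth
(`contDiffOn_comp_ofCanonicalCoords`).
-/

open scoped Manifold ContDiff

noncomputable section

namespace Fedosov

/-! ### Partial derivatives -/

section PartialDeriv

variable {ι : Type} [Fintype ι] [DecidableEq ι] {F : Type} [NormedAddCommGroup F]
  [NormedSpace ℝ F] {Ω : Set (ι → ℝ)}

theorem partialDeriv_eqOn (hΩ : IsOpen Ω) (i : ι) {f g : (ι → ℝ) → F} (h : Set.EqOn f g Ω) :
    Set.EqOn (partialDeriv i f) (partialDeriv i g) Ω := fun x hx => by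
  unfold partialDeriv
  rw [(h.eventuallyEq_of_mem (hΩ.mem_nhds hx)).fderiv_eq]

theorem contDiffOn_partialDeriv (hΩ : IsOpen Ω) (i : ι) {f : (ι → ℝ) → F}
    (hf : ContDiffOn ℝ ∞ f Ω) : ContDiffOn ℝ ∞ (partialDeriv i f) Ω :=
  (hf.fderiv_of_isOpen hΩ (by simp)).clm_apply contDiffOn_const

omit [DecidableEq ι] in
theorem differentiableAt_of_contDiffOn (hΩ : IsOpen Ω) {f : (ι → ℝ) → F}
    (hf : ContDiffOn ℝ ∞ f Ω) {x : ι → ℝ} (hx : x ∈ Ω) : DifferentiableAt ℝ f x :=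
  (hf.contDiffAt (hΩ.mem_nhds hx)).differentiableAt (by simp)

theorem partialDeriv_comm (hΩ : IsOpen Ω) (i j : ι) {f : (ι → ℝ) → F}
    (hf : ContDiffOn ℝ ∞ f Ω) :
    Set.EqOn (partialDeriv i (partialDeriv j f)) (partialDeriv j (partialDeriv i f)) Ω :=
  fun x hx => by
  have hd : DifferentiableAt ℝ (fderiv ℝ f) x :=
    ((hf.fderiv_of_isOpen hΩ (m := ∞) (by simp)).contDiffAt (hΩ.mem_nhds hx)).differentiableAt
      (by simp)
  have hsymm := (hf.contDiffAt (hΩ.mem_nhds hx)).isSymmSndFDerivAt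
    (by simpa using ENat.LEInfty.out)
  unfold partialDeriv
  rw [fderiv_clm_apply hd (differentiableAt_const _),
    fderiv_clm_apply hd (differentiableAt_const _)]
  simpa using hsymm (Pi.single i 1) (Pi.single j 1)

end PartialDeriv

/-! ### Functions polynomial in the momenta -/

section IsPol

variable {n : ℕ} {F G : Type} [NormedAddCommGroup F] [NormedSpace ℝ F] [NormedAddCommGroup G]
  [NormedSpace ℝ G] {Ω : Set (Phase n)}

/-- `f` is smooth on `Ω` and all its `d`-fold derivatives in the momenta vanish there. On a set
of the form `U × ℝⁿ` this says that `f` is, in the momenta, a polynomial of degree less than `d`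
with smooth coefficients. The recursion avoids naming the coefficients; for `d = 0` it says that
`f` vanishes on `Ω`. -/
def IsPol (Ω : Set (Phase n)) : ℕ → (Phase n → F) → Prop
  | 0, f => Set.EqOn f 0 Ω
  | d + 1, f => ContDiffOn ℝ ∞ f Ω ∧ ∀ i, IsPol Ω d (partialDeriv (Sum.inr i) f)

theorem IsPol.congr (hΩ : IsOpen Ω) : ∀ {d : ℕ} {f g : Phase n → F}, IsPol Ω d f →
    Set.EqOn f g Ω → IsPol Ω d g
  | 0, _, _, hf, h => h.symm.trans hf
  | _ + 1, _, _, hf, h => ⟨hf.1.congr h.symm,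
      fun i => (hf.2 i).congr hΩ (partialDeriv_eqOn hΩ _ h)⟩

theorem IsPol.contDiffOn : ∀ {d : ℕ} {f : Phase n → F}, IsPol Ω d f → ContDiffOn ℝ ∞ f Ω
  | 0, _, hf => contDiffOn_const.congr hf
  | _ + 1, _, hf => hf.1

theorem IsPol.zero (hΩ : IsOpen Ω) : ∀ d : ℕ, IsPol Ω d (0 : Phase n → F)
  | 0 => fun _ _ => rfl
  | d + 1 => ⟨contDiffOn_const, fun i => (IsPol.zero hΩ d).congr hΩ fun x _ => by
      simp [partialDeriv]⟩

theorem IsPol.of_eqOn_zero (hΩ : IsOpen Ω) {f : Phase n → F} (hf : Set.EqOn f 0 Ω) (d : ℕ) :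
    IsPol Ω d f :=
  (IsPol.zero hΩ d).congr hΩ hf.symm

theorem IsPol.succ (hΩ : IsOpen Ω) : ∀ {d : ℕ} {f : Phase n → F}, IsPol Ω d f →
    IsPol Ω (d + 1) f
  | 0, _, hf => IsPol.of_eqOn_zero hΩ hf 1
  | _ + 1, _, hf => ⟨hf.1, fun i => (hf.2 i).succ hΩ⟩

theorem IsPol.add (hΩ : IsOpen Ω) : ∀ {d : ℕ} {f g : Phase n → F}, IsPol Ω d f → IsPol Ω d g →
    IsPol Ω d (f + g)
  | 0, _, _, hf, hg => fun x hx => by simp [hf hx, hg hx]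
  | _ + 1, f, g, hf, hg => ⟨hf.1.add hg.1, fun i => ((hf.2 i).add hΩ (hg.2 i)).congr hΩ
      fun x hx => by
        simp [partialDeriv, fderiv_add (differentiableAt_of_contDiffOn hΩ hf.1 hx)
          (differentiableAt_of_contDiffOn hΩ hg.1 hx)]⟩

theorem IsPol.clm_comp (hΩ : IsOpen Ω) (L : F →L[ℝ] G) : ∀ {d : ℕ} {f : Phase n → F},
    IsPol Ω d f → IsPol Ω d fun x => L (f x)
  | 0, _, hf => fun x hx => by simp [hf hx]
  | _ + 1, f, hf => ⟨L.contDiff.comp_contDiffOn hf.1, fun i => ((hf.2 i).clm_comp hΩ L).congr hΩ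
      fun x hx => by
        have h := (L.hasFDerivAt.comp x
          (differentiableAt_of_contDiffOn hΩ hf.1 hx).hasFDerivAt).fderiv
        change _ = fderiv ℝ (⇑L ∘ f) x _
        rw [h]
        rfl⟩

theorem IsPol.const_smul (hΩ : IsOpen Ω) (c : ℂ) {d : ℕ} {f : Phase n → ℂ}
    (hf : IsPol Ω d f) : IsPol Ω d (c • f) :=
  hf.clm_comp hΩ (c • ContinuousLinearMap.id ℝ ℂ)

theorem IsPol.neg (hΩ : IsOpen Ω) {d : ℕ} {f : Phase n → F} (hf : IsPol Ω d f) :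
    IsPol Ω d (-f) :=
  hf.clm_comp hΩ (-ContinuousLinearMap.id ℝ F)

theorem IsPol.sub (hΩ : IsOpen Ω) {d : ℕ} {f g : Phase n → F} (hf : IsPol Ω d f)
    (hg : IsPol Ω d g) : IsPol Ω d (f - g) := by
  rw [sub_eq_add_neg]
  exact hf.add hΩ (hg.neg hΩ)

theorem IsPol.sum (hΩ : IsOpen Ω) {κ : Type*} (s : Finset κ) {d : ℕ} {f : κ → Phase n → F}
    (hf : ∀ k ∈ s, IsPol Ω d (f k)) : IsPol Ω d (∑ k ∈ s, f k) :=
  Finset.sum_induction f (IsPol Ω d) (fun _ _ => IsPol.add hΩ) (IsPol.zero hΩ d) hf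

/-- Degrees add up under multiplication; as `IsPol` bounds the degree strictly, one is left over,
and a factor of degree less than zero, which vanishes, is excluded. -/
theorem IsPol.mul_succ {A : Type} [NormedRing A] [NormedAlgebra ℝ A] (hΩ : IsOpen Ω) :
    ∀ {s d e : ℕ} {f g : Phase n → A}, d + e = s → IsPol Ω (d + 1) f → IsPol Ω (e + 1) g →
    IsPol Ω (d + e + 1) (f * g)
  -- The recursion is on `s = d + e`, as the Leibniz rule lowers either degree.
  | s, d, e, f, g, hs, hf, hg => by
    refine ⟨hf.1.mul hg.1, fun i => ?_⟩
    have h1 : IsPol Ω (d + e) (f * partialDeriv (Sum.inr i) g) := by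
      cases e with
      | zero => exact .of_eqOn_zero hΩ (fun x hx => by simp [hg.2 i hx]) _
      | succ e =>
        cases s with
        | zero => omega
        | succ s => exact IsPol.mul_succ hΩ (s := s) (by omega) hf (hg.2 i)
    have h2 : IsPol Ω (d + e) (partialDeriv (Sum.inr i) f * g) := by
      cases d with
      | zero => exact .of_eqOn_zero hΩ (fun x hx => by simp [hf.2 i hx]) _
      | succ d =>
        cases s with
        | zero => omega
        | succ s =>
          have := IsPol.mul_succ hΩ (s := s) (by omega) (hf.2 i) hg
          rwa [Nat.add_right_comm] at this
    refine (h1.add hΩ h2).congr hΩ fun x hx => ?_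
    simp [partialDeriv, fderiv_mul' (differentiableAt_of_contDiffOn hΩ hf.1 hx)
      (differentiableAt_of_contDiffOn hΩ hg.1 hx)]

theorem IsPol.partialDeriv_inr (hΩ : IsOpen Ω) (i : Fin n) {d : ℕ} {f : Phase n → F}
    (hf : IsPol Ω d f) : IsPol Ω (d - 1) (partialDeriv (Sum.inr i) f) := by
  cases d with
  | zero => exact (hf.succ hΩ).2 i
  | succ d => exact hf.2 i

/-- Derivatives in the positions commute with those in the momenta, and so keep the degree. -/
theorem IsPol.partialDeriv_inl (hΩ : IsOpen Ω) (i : Fin n) : ∀ {d : ℕ} {f : Phase n → F},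
    IsPol Ω d f → IsPol Ω d (partialDeriv (Sum.inl i) f)
  | 0, f, hf => fun x hx => by
      rw [partialDeriv_eqOn hΩ _ hf hx]
      simp [partialDeriv]
  | _ + 1, _, hf => ⟨contDiffOn_partialDeriv hΩ _ hf.1, fun j =>
      ((hf.2 j).partialDeriv_inl hΩ i).congr hΩ (partialDeriv_comm hΩ _ _ hf.1)⟩

/-- A function of the positions alone has degree zero in the momenta. -/
theorem isPol_base {U : Set (Fin n → ℝ)} (hU : IsOpen U) {c : (Fin n → ℝ) → F}
    (hc : ContDiffOn ℝ ∞ c U) :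
    IsPol ((fun x : Phase n => x ∘ Sum.inl) ⁻¹' U) 1 fun x => c (x ∘ Sum.inl) := by
  let L : Phase n →L[ℝ] (Fin n → ℝ) :=
    ContinuousLinearMap.pi fun i => ContinuousLinearMap.proj (Sum.inl i)
  refine ⟨hc.comp L.contDiff.contDiffOn fun x hx => hx, fun i x hx => ?_⟩
  have h := ((differentiableAt_of_contDiffOn hU hc hx).hasFDerivAt.comp x
    (f := L) L.hasFDerivAt).fderiv
  change fderiv ℝ (c ∘ L) x _ = _
  rw [h]
  have : L (Pi.single (Sum.inr i) 1) = 0 := by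
    ext j
    simp [L]
  simp [this]

theorem isPol_momentum (a : Fin n) :
    IsPol Ω 2 fun x : Phase n => x (Sum.inr a) := by
  have h : ∀ i x, partialDeriv i (fun x : Phase n => x (Sum.inr a)) x
      = (Pi.single i 1 : Phase n) (Sum.inr a) := fun i x => by
    exact congrArg (fun L : Phase n →L[ℝ] ℝ => L (Pi.single i 1))
      (hasFDerivAt_apply (𝕜 := ℝ) (Sum.inr a) x).fderiv
  refine ⟨contDiffOn_pi.1 contDiffOn_id _, fun i => ⟨?_, fun j x hx => ?_⟩⟩
  · exact contDiffOn_const.congr fun x _ => h _ x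
  · rw [show partialDeriv (Sum.inr i) (fun x : Phase n => x (Sum.inr a))
      = fun _ => (Pi.single (Sum.inr i) 1 : Phase n) (Sum.inr a) from funext (h _)]
    simp [partialDeriv]

theorem totalDegree_pderiv_le {σ : Type*} {N : ℕ} (i : σ) {P : MvPolynomial σ ℂ}
    (hP : P.totalDegree ≤ N + 1) : (MvPolynomial.pderiv i P).totalDegree ≤ N := by
  refine Finset.sup_le fun m hm => ?_
  have hm' : m + Finsupp.single i 1 ∈ P.support := by
    rw [MvPolynomial.mem_support_iff, MvPolynomial.coeff_pderiv] at hm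
    exact MvPolynomial.mem_support_iff.2 (left_ne_zero_of_mul hm)
  have h := (MvPolynomial.le_totalDegree hm').trans hP
  rw [Finsupp.sum_add_index' (by simp) (by simp), Finsupp.sum_single_index rfl] at h
  omega

theorem hasDerivAt_eval_pderiv (P : MvPolynomial (Fin n) ℂ) (i : Fin n) (p : Fin n → ℝ) :
    HasDerivAt (fun t : ℝ => MvPolynomial.eval
      (fun j => ((p + t • (Pi.single i 1 : Fin n → ℝ)) j : ℂ)) P)
      (MvPolynomial.eval (fun j => (p j : ℂ)) (MvPolynomial.pderiv i P)) 0 := by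
  induction P using MvPolynomial.induction_on with
  | C a => simpa using hasDerivAt_const (0 : ℝ) a
  | add P Q hP hQ => simpa using! hP.add hQ
  | mul_X P j hP =>
    have hX : HasDerivAt (fun t : ℝ => ((p + t • (Pi.single i 1 : Fin n → ℝ)) j : ℂ))
        ((Pi.single i 1 : Fin n → ℝ) j : ℂ) 0 := by
      have := ((hasDerivAt_id (0 : ℝ)).smul_const (Pi.single i 1 : Fin n → ℝ)).const_add p
      simpa using ((hasDerivAt_pi.1 this) j).ofReal_comp
    have h := hP.mul hX
    simp only [map_mul, MvPolynomial.eval_X, Derivation.leibniz, MvPolynomial.pderiv_X]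
    convert! h using 1
    by_cases hij : i = j
    · subst hij
      simp
      ring
    · simp [Ne.symm hij]
      ring

/-- A smooth function that restricts to a polynomial of degree at most `N` in the momenta at
every position has degree at most `N` in the momenta. -/
theorem isPol_of_fiberwise {U : Set (Fin n → ℝ)} (hU : IsOpen U) :
    ∀ (N : ℕ) {f : Phase n → ℂ}, ContDiffOn ℝ ∞ f ((fun x : Phase n => x ∘ Sum.inl) ⁻¹' U) →
    (∀ q ∈ U, ∃ P : MvPolynomial (Fin n) ℂ, P.totalDegree ≤ N ∧
      ∀ p : Fin n → ℝ, f (Sum.elim q p) = MvPolynomial.eval (fun i => (p i : ℂ)) P) →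
    IsPol ((fun x : Phase n => x ∘ Sum.inl) ⁻¹' U) (N + 1) f := by
  have hΩ : IsOpen ((fun x : Phase n => x ∘ Sum.inl) ⁻¹' U) := hU.preimage (by fun_prop)
  -- The derivative of `f` in `p_i` is fibrewise the formal derivative of the polynomial.
  have key : ∀ {f : Phase n → ℂ},
      ContDiffOn ℝ ∞ f ((fun x : Phase n => x ∘ Sum.inl) ⁻¹' U) → ∀ q ∈ U,
      ∀ P : MvPolynomial (Fin n) ℂ,
      (∀ p : Fin n → ℝ, f (Sum.elim q p) = MvPolynomial.eval (fun i => (p i : ℂ)) P) →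
      ∀ (i : Fin n) (p : Fin n → ℝ), partialDeriv (Sum.inr i) f (Sum.elim q p)
        = MvPolynomial.eval (fun i => (p i : ℂ)) (MvPolynomial.pderiv i P) := by
    intro f hf q hq P hP i p
    have hd := (differentiableAt_of_contDiffOn hΩ hf (x := Sum.elim q p) hq).hasFDerivAt
    have hline : HasDerivAt (fun t : ℝ => (Sum.elim q p : Phase n) + t • Pi.single (Sum.inr i) 1)
        (Pi.single (Sum.inr i) 1) 0 := by
      simpa using ((hasDerivAt_id (0 : ℝ)).smul_const
        (Pi.single (Sum.inr i) 1 : Phase n)).const_add (Sum.elim q p)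
    have h := HasFDerivAt.comp_hasDerivAt (l := f) (0 : ℝ) (by simpa using hd) hline
    refine h.unique ((hasDerivAt_eval_pderiv P i p).congr_of_eventuallyEq (.of_forall fun t => ?_))
    rw [Function.comp_apply]
    refine (congrArg f ?_).trans (hP _)
    ext (j | j) <;> simp [Pi.single_apply]
  intro N
  induction N with
  | zero =>
    refine fun hf h => ⟨hf, fun i x hx => ?_⟩
    obtain ⟨P, hP, hfP⟩ := h _ hx
    have := key hf _ hx P hfP i (x ∘ Sum.inr)
    rw [Sum.elim_comp_inl_inr] at this
    rw [this, MvPolynomial.totalDegree_eq_zero_iff_eq_C.1 (Nat.le_zero.1 hP)]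
    simp
  | succ N ih =>
    refine fun hf h => ⟨hf, fun i => ih (contDiffOn_partialDeriv hΩ _ hf) fun q hq => ?_⟩
    obtain ⟨P, hP, hfP⟩ := h _ hq
    exact ⟨_, totalDegree_pderiv_le i hP, key hf q hq P hfP i⟩

end IsPol

/-! ### Weights -/

section Weight

variable {n : ℕ} {Ω : Set (Phase n)}

/-- `f` is smooth on `Ω` and of degree at most `w` in the momenta; for negative `w` it vanishes. -/
def HasDegree {F : Type} [NormedAddCommGroup F] [NormedSpace ℝ F] (Ω : Set (Phase n)) (w : ℤ)
    (f : Phase n → F) : Prop :=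
  IsPol Ω (w + 1).toNat f

theorem HasDegree.mul {A : Type} [NormedRing A] [NormedAlgebra ℝ A] (hΩ : IsOpen Ω) {v w u : ℤ}
    {f g : Phase n → A} (hf : HasDegree Ω v f) (hg : HasDegree Ω w g) (hu : v + w = u) :
    HasDegree Ω u (f * g) := by
  unfold HasDegree at hf hg ⊢
  -- A factor of negative degree vanishes; this case needs no relation between the degrees.
  rcases h : (v + 1).toNat with _ | d
  · rw [h] at hf
    exact .of_eqOn_zero hΩ (fun x hx => by simp [hf hx]) _
  rcases h' : (w + 1).toNat with _ | e
  · rw [h'] at hg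
    exact .of_eqOn_zero hΩ (fun x hx => by simp [hg hx]) _
  rw [h] at hf
  rw [h'] at hg
  rw [show (u + 1).toNat = d + e + 1 by omega]
  exact IsPol.mul_succ hΩ rfl hf hg

/-- The weight of `x^μ`, of `y^μ` and of `dx^μ`: zero for positions, one for momenta. -/
def wt : Idx n → ℤ
  | .inl _ => 0
  | .inr _ => 1

theorem HasDegree.partialDeriv {F : Type} [NormedAddCommGroup F] [NormedSpace ℝ F]
    (hΩ : IsOpen Ω) {w : ℤ} {f : Phase n → F} (hf : HasDegree Ω w f) (μ : Idx n) :
    HasDegree Ω (w - wt μ) (partialDeriv μ f) := by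
  cases μ with
  | inl i => simpa [wt] using! IsPol.partialDeriv_inl hΩ i hf
  | inr i =>
    have h := IsPol.partialDeriv_inr hΩ i hf
    unfold HasDegree
    rwa [show (w - wt (Sum.inr i : Idx n) + 1).toNat = (w + 1).toNat - 1 by simp only [wt]; omega]

/-- The degree of `y^α` in the generators `y^{p_i}`, which is the weight of `y^α`. -/
def momDegree (α : Idx n →₀ ℕ) : ℤ := ∑ i, (α (Sum.inr i) : ℤ)

theorem momDegree_add (α β : Idx n →₀ ℕ) : momDegree (α + β) = momDegree α + momDegree β := by
  simp [momDegree, Finset.sum_add_distrib]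

theorem momDegree_zero : momDegree (0 : Idx n →₀ ℕ) = 0 := by simp [momDegree]

theorem momDegree_single (μ : Idx n) : momDegree (Finsupp.single μ 1) = wt μ := by
  cases μ <;> simp [momDegree, wt, Finsupp.single_apply]

/-- The section `a` of the Weyl bundle has, over `Ω`, only terms of weight at most `w`: the
momenta `p_i`, the generators `y^{p_i}` and `ħ` have weight one, positions and the generators
`y^{q^i}` have weight zero. -/
def HasWeight (Ω : Set (Phase n)) (w : ℤ) (a : Weyl n) : Prop :=
  ∀ (k : ℕ) (α : Idx n →₀ ℕ), HasDegree Ω (w - k - momDegree α) (a.coeff k α)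

theorem HasWeight.zero (hΩ : IsOpen Ω) (w : ℤ) : HasWeight Ω w (0 : Weyl n) :=
  fun _ _ => IsPol.zero hΩ _

theorem HasWeight.add (hΩ : IsOpen Ω) {w : ℤ} {a b : Weyl n} (ha : HasWeight Ω w a)
    (hb : HasWeight Ω w b) : HasWeight Ω w (a + b) :=
  fun k α => IsPol.add hΩ (ha k α) (hb k α)

theorem HasWeight.sub (hΩ : IsOpen Ω) {w : ℤ} {a b : Weyl n} (ha : HasWeight Ω w a)
    (hb : HasWeight Ω w b) : HasWeight Ω w (a - b) :=
  fun k α => IsPol.sub hΩ (ha k α) (hb k α)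

theorem HasWeight.smul (hΩ : IsOpen Ω) {w : ℤ} (c : ℂ) {a : Weyl n} (ha : HasWeight Ω w a) :
    HasWeight Ω w (c • a) :=
  fun k α => IsPol.const_smul hΩ c (ha k α)

theorem HasWeight.sum (hΩ : IsOpen Ω) {κ : Type*} (s : Finset κ) {w : ℤ} {a : κ → Weyl n}
    (ha : ∀ i ∈ s, HasWeight Ω w (a i)) : HasWeight Ω w (∑ i ∈ s, a i) :=
  Finset.sum_induction a (HasWeight Ω w) (fun _ _ => HasWeight.add hΩ) (HasWeight.zero hΩ w) ha

theorem HasWeight.mul (hΩ : IsOpen Ω) {v w : ℤ} {a b : Weyl n} (ha : HasWeight Ω v a)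
    (hb : HasWeight Ω w b) : HasWeight Ω (v + w) (a * b) := by
  classical
  intro k α
  unfold Weyl.coeff
  rw [PowerSeries.coeff_mul, map_sum]
  refine IsPol.sum hΩ _ fun kl hkl => ?_
  rw [MvPowerSeries.coeff_mul]
  refine IsPol.sum hΩ _ fun βγ hβγ => ?_
  refine HasDegree.mul hΩ (ha kl.1 βγ.1) (hb kl.2 βγ.2) ?_
  rw [← Finset.HasAntidiagonal.mem_antidiagonal.1 hβγ,
    ← Finset.HasAntidiagonal.mem_antidiagonal.1 hkl, momDegree_add]
  push_cast
  ring

theorem hasWeight_ofFun (hΩ : IsOpen Ω) {w : ℤ} {f : Phase n → ℂ} (hf : HasDegree Ω w f) :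
    HasWeight Ω w (Weyl.ofFun f) := by
  classical
  intro k α
  unfold Weyl.coeff Weyl.ofFun
  rw [PowerSeries.coeff_C]
  split_ifs with hk
  · rw [MvPowerSeries.coeff_C]
    split_ifs with hα
    · simpa [hk, hα, momDegree_zero] using hf
    · exact IsPol.zero hΩ _
  · exact IsPol.zero hΩ _

theorem hasWeight_ofReal (hΩ : IsOpen Ω) {w : ℤ} {f : Phase n → ℝ} (hf : HasDegree Ω w f) :
    HasWeight Ω w (Weyl.ofReal f) :=
  hasWeight_ofFun hΩ (IsPol.clm_comp hΩ Complex.ofRealCLM hf)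

theorem hasDegree_one : HasDegree Ω 0 (1 : Phase n → ℂ) :=
  ⟨contDiffOn_const, fun i x _ => by
    simp [partialDeriv, show (1 : Phase n → ℂ) = fun _ => 1 from rfl]⟩

theorem hasWeight_y (hΩ : IsOpen Ω) (μ : Idx n) : HasWeight Ω (wt μ) (Weyl.y μ) := by
  classical
  intro k α
  unfold Weyl.coeff Weyl.y
  rw [PowerSeries.coeff_C]
  split_ifs with hk
  · rw [MvPowerSeries.coeff_X]
    split_ifs with hα
    · simpa [hk, hα, momDegree_single] using hasDegree_one
    · exact IsPol.zero hΩ _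
  · exact IsPol.zero hΩ _

theorem HasWeight.dy (hΩ : IsOpen Ω) {w : ℤ} {a : Weyl n} (ha : HasWeight Ω w a) (μ : Idx n) :
    HasWeight Ω (w - wt μ) (Weyl.dy μ a) := by
  intro k α
  unfold Weyl.coeff Weyl.dy
  rw [PowerSeries.coeff_mk, MvPowerSeries.coeff_pderiv]
  have h := IsPol.const_smul hΩ ((α μ : ℂ) + 1) (ha k (α + Finsupp.single μ 1))
  rw [momDegree_add, momDegree_single] at h
  rw [show w - wt μ - k - momDegree α = w - k - (momDegree α + wt μ) by ring]
  refine h.congr hΩ fun x _ => ?_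
  simp [Weyl.coeff, mul_comm]

theorem HasWeight.dx (hΩ : IsOpen Ω) {w : ℤ} {a : Weyl n} (ha : HasWeight Ω w a) (μ : Idx n) :
    HasWeight Ω (w - wt μ) (Weyl.dx μ a) := by
  intro k α
  unfold Weyl.dx
  rw [Weyl.coeff_mk, show w - wt μ - k - momDegree α = w - k - momDegree α - wt μ by ring]
  exact (ha k α).partialDeriv hΩ μ

theorem HasWeight.scale (hΩ : IsOpen Ω) {w : ℤ} {a : Weyl n} (ha : HasWeight Ω w a)
    (c : ℕ → ℂ) : HasWeight Ω w (Weyl.scale c a) := by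
  intro k α
  unfold Weyl.scale
  rw [Weyl.coeff_mk]
  exact IsPol.const_smul hΩ _ (ha k α)

theorem HasWeight.iOverHbar (hΩ : IsOpen Ω) {w : ℤ} {a : Weyl n} (ha : HasWeight Ω (w + 1) a) :
    HasWeight Ω w (Weyl.iOverHbar a) := by
  intro k α
  unfold Weyl.iOverHbar
  rw [Weyl.coeff_mk]
  have h := ha (k + 1) α
  rw [show w + 1 - (k + 1 : ℕ) - momDegree α = w - k - momDegree α by push_cast; ring] at h
  exact IsPol.const_smul hΩ _ h

/-- The coefficients of the limit are coefficients of members of the sequence, so convergence plays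
no role. -/
theorem HasWeight.lim {w : ℤ} {s : ℕ → Weyl n} (hs : ∀ m, HasWeight Ω w (s m)) :
    HasWeight Ω w (Weyl.lim s) := by
  intro k α
  unfold Weyl.lim
  rw [Weyl.coeff_mk]
  exact hs _ k α

/-! ### The Weyl product -/

/-- The symplectic form pairs positions with momenta. -/
theorem omega_eq_zero {μ ν : Idx n} (h : wt μ + wt ν ≠ 1) : omega n μ ν = 0 := by
  rcases μ with i | i <;> rcases ν with j | j <;> simp_all [omega, Matrix.J, wt]

theorem omegaInv_eq_zero {μ ν : Idx n} (h : wt μ + wt ν ≠ 1) : omegaInv n μ ν = 0 := by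
  have hinv : omegaInv n = -omega n := by
    unfold omegaInv omega
    exact Matrix.inv_eq_right_inv (by rw [mul_neg, Matrix.J_squared, neg_neg])
  rw [hinv, Matrix.neg_apply, omega_eq_zero h, neg_zero]

/-- Each contraction with the Poisson tensor lowers the weight by one. -/
theorem HasWeight.contract (hΩ : IsOpen Ω) (t : ℕ) : ∀ {v w : ℤ} {a b : Weyl n},
    HasWeight Ω v a → HasWeight Ω w b → HasWeight Ω (v + w - t) (Weyl.contract t a b) := by
  induction t with
  | zero => exact fun ha hb => by simpa using! ha.mul hΩ hb
  | succ t ih =>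
    intro v w a b ha hb
    refine HasWeight.sum hΩ _ fun μ _ => HasWeight.sum hΩ _ fun ν _ => ?_
    by_cases h : wt μ + wt ν = 1
    · have := (ih (ha.dy hΩ μ) (hb.dy hΩ ν)).smul hΩ (omegaInv n μ ν : ℂ)
      rwa [show v - wt μ + (w - wt ν) - t = v + w - (t + 1 : ℕ) by push_cast; linarith] at this
    · rw [omegaInv_eq_zero h, Complex.ofReal_zero, zero_smul]
      exact .zero hΩ _

/-- The factor `ħ^t` in the Weyl product makes up for the weight lost in `t` contractions. -/
theorem HasWeight.prod (hΩ : IsOpen Ω) {v w : ℤ} {a b : Weyl n} (ha : HasWeight Ω v a)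
    (hb : HasWeight Ω w b) : HasWeight Ω (v + w) (Weyl.prod a b) := by
  intro k α
  unfold Weyl.prod
  rw [Weyl.coeff_mk]
  refine IsPol.sum hΩ _ fun t ht => IsPol.const_smul hΩ _ ?_
  have h := ha.contract hΩ t hb (k - t) α
  rwa [Nat.cast_sub (Nat.lt_succ_iff.1 (Finset.mem_range.1 ht)),
    show v + w - t - (k - t : ℤ) - momDegree α = v + w - k - momDegree α by ring] at h

theorem HasWeight.comm (hΩ : IsOpen Ω) {v w : ℤ} {a b : Weyl n} (ha : HasWeight Ω v a)
    (hb : HasWeight Ω w b) : HasWeight Ω (v + w) (Weyl.comm a b) :=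
  (ha.prod hΩ hb).sub hΩ (by rw [add_comm]; exact hb.prod hΩ ha)

/-! ### Fedosov's construction for a connection of weight zero -/

/-- The coefficients `Γ^i_{jk}` of a connection of weight zero, that is, one whose exterior
covariant derivative preserves weights when `dp_i` has weight one. -/
def IsWeightZero (Ω : Set (Phase n)) (Γ : Idx n → Idx n → Idx n → Phase n → ℝ) : Prop :=
  ∀ i j k, HasDegree Ω (wt i - wt j - wt k) (Γ i j k)

variable {Γ : Idx n → Idx n → Idx n → Phase n → ℝ}

/-- If `a` has weight at most `w`, then so has the one-form `∇a`, whose `ν`-th component therefore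
has weight at most `w - wt ν`. -/
theorem HasWeight.nabla (hΩ : IsOpen Ω) (hΓ : IsWeightZero Ω Γ) {w : ℤ} {a : Weyl n}
    (ha : HasWeight Ω w a) (ν : Idx n) : HasWeight Ω (w - wt ν) (nabla Γ a ν) := by
  refine (ha.dx hΩ ν).sub hΩ (.sum hΩ _ fun i _ => .sum hΩ _ fun c _ => ?_)
  convert! ((hasWeight_ofReal hΩ (hΓ i c ν)).mul hΩ (hasWeight_y hΩ c)).mul hΩ (ha.dy hΩ i) using 1
  ring

theorem HasWeight.deltaInvOne (hΩ : IsOpen Ω) {w : ℤ} {η : Idx n → Weyl n}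
    (hη : ∀ μ, HasWeight Ω (w - wt μ) (η μ)) : HasWeight Ω w (deltaInvOne η) := by
  refine HasWeight.scale hΩ (.sum hΩ _ fun μ _ => ?_) _
  convert! (hasWeight_y hΩ μ).mul hΩ (hη μ) using 1
  ring

theorem HasWeight.deltaInvTwo (hΩ : IsOpen Ω) {w : ℤ} {θ : Idx n → Idx n → Weyl n}
    (hθ : ∀ μ ν, HasWeight Ω (w - wt μ - wt ν) (θ μ ν)) (ν : Idx n) :
    HasWeight Ω (w - wt ν) (deltaInvTwo θ ν) := by
  refine HasWeight.scale hΩ (.sum hΩ _ fun μ _ => ?_) _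
  convert! (hasWeight_y hΩ μ).mul hΩ (hθ μ ν) using 1
  ring

theorem IsWeightZero.curvature (hΩ : IsOpen Ω) (hΓ : IsWeightZero Ω Γ) (i j k l : Idx n) :
    HasDegree Ω (wt i - wt j - wt k - wt l) (curvature Γ i j k l) := by
  have h1 := (hΓ i l j).partialDeriv hΩ k
  have h2 := (hΓ i k j).partialDeriv hΩ l
  rw [show wt i - wt l - wt j - wt k = wt i - wt j - wt k - wt l by ring] at h1
  rw [show wt i - wt k - wt j - wt l = wt i - wt j - wt k - wt l by ring] at h2
  have h3 : HasDegree Ω (wt i - wt j - wt k - wt l)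
      (∑ m, (Γ i k m * Γ m l j - Γ i l m * Γ m k j)) :=
    IsPol.sum hΩ _ fun m _ => IsPol.sub hΩ
      ((hΓ i k m).mul hΩ (hΓ m l j) (by ring)) ((hΓ i l m).mul hΩ (hΓ m k j) (by ring))
  refine (IsPol.add hΩ (IsPol.sub hΩ h1 h2) h3).congr hΩ fun x _ => ?_
  simp [Fedosov.curvature]

/-- As a two-form, `R̂` has weight one, the weight of the symplectic form. -/
theorem hasWeight_curvatureHat (hΩ : IsOpen Ω) (hΓ : IsWeightZero Ω Γ) (k l : Idx n) :
    HasWeight Ω (1 - wt k - wt l) (curvatureHat Γ k l) := by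
  refine .sum hΩ _ fun i _ => .sum hΩ _ fun j _ => ?_
  have h : HasDegree Ω (1 - wt i - wt j - wt k - wt l)
      (∑ m, fun x => (-(1 / 2) * omega n i m) * curvature Γ m j k l x) := by
    refine IsPol.sum hΩ _ fun m _ => ?_
    by_cases hm : wt i + wt m = 1
    · rw [show 1 - wt i - wt j - wt k - wt l = wt m - wt j - wt k - wt l by linarith]
      exact IsPol.clm_comp hΩ ((-(1 / 2) * omega n i m) • ContinuousLinearMap.id ℝ ℝ)
        (hΓ.curvature hΩ m j k l)
    · exact .of_eqOn_zero hΩ (fun x _ => by simp [omega_eq_zero hm]) _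
  have h' : HasDegree Ω (1 - wt i - wt j - wt k - wt l)
      (fun x => -(1 / 2) * ∑ m, omega n i m * curvature Γ m j k l x) :=
    h.congr hΩ fun x _ => by
      rw [Finset.sum_apply, Finset.mul_sum]
      exact Finset.sum_congr rfl fun m _ => mul_assoc _ _ _
  convert! ((hasWeight_ofReal hΩ h').mul hΩ (hasWeight_y hΩ i)).mul hΩ (hasWeight_y hΩ j) using 1
  ring

theorem hasWeight_formIter (hΩ : IsOpen Ω) (hΓ : IsWeightZero Ω Γ) (m : ℕ) :
    ∀ μ, HasWeight Ω (1 - wt μ) (formIter Γ m μ) := by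
  induction m with
  | zero => exact fun μ => .zero hΩ _
  | succ m ih =>
    refine HasWeight.deltaInvTwo hΩ fun μ ν => ((hasWeight_curvatureHat hΩ hΓ μ ν).add hΩ
      (HasWeight.sub hΩ ?_ ((ih μ).nabla hΩ hΓ ν))).add hΩ (HasWeight.iOverHbar hΩ ?_)
    · convert! (ih ν).nabla hΩ hΓ μ using 1
      ring
    · convert! (ih μ).comm hΩ (ih ν) using 1
      ring

/-- As a one-form, `r` has weight one. -/
theorem hasWeight_fedosovForm (hΩ : IsOpen Ω) (hΓ : IsWeightZero Ω Γ) (μ : Idx n) :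
    HasWeight Ω (1 - wt μ) (fedosovForm Γ μ) :=
  .lim fun m => hasWeight_formIter hΩ hΓ m μ

theorem hasWeight_flatLift (hΩ : IsOpen Ω) (hΓ : IsWeightZero Ω Γ) {w : ℤ} {f : Phase n → ℂ}
    (hf : HasDegree Ω w f) : HasWeight Ω w (flatLift Γ f) := by
  refine .lim fun m => ?_
  induction m with
  | zero => exact hasWeight_ofFun hΩ hf
  | succ m ih =>
    refine (hasWeight_ofFun hΩ hf).add hΩ (.deltaInvOne hΩ fun μ => (ih.nabla hΩ hΓ μ).add hΩ
      (.iOverHbar hΩ ?_))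
    convert! (hasWeight_fedosovForm hΩ hΓ μ).comm hΩ ih using 1
    ring

/-- The coefficient of `ħ^k` in a series of weight at most `N + M` has degree at most `N + M - k` in
the momenta, hence vanishes for `k > N + M`. -/
theorem coeff_coordStar_eq_zero (hΩ : IsOpen Ω) (hΓ : IsWeightZero Ω Γ) {N M : ℕ}
    {f h : Phase n → ℂ} (hf : HasDegree Ω N f) (hh : HasDegree Ω M h) {k : ℕ} (hk : N + M < k)
    {x : Phase n} (hx : x ∈ Ω) : PowerSeries.coeff k (coordStar Γ f h) x = 0 := by
  have hw := (hasWeight_flatLift hΩ hΓ hf).prod hΩ (hasWeight_flatLift hΩ hΓ hh) k 0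
  unfold HasDegree at hw
  rw [momDegree_zero, show ((N : ℤ) + M - k - 0 + 1).toNat = 0 by omega] at hw
  unfold coordStar
  rw [PowerSeries.coeff_mk]
  exact hw hx

/-! ### The lifted connection -/

theorem HasDegree.of_base {U : Set (Fin n → ℝ)} (hU : IsOpen U) {c : (Fin n → ℝ) → ℝ}
    (hc : ContDiffOn ℝ ∞ c U) :
    HasDegree ((fun x : Phase n => x ∘ Sum.inl) ⁻¹' U) 0 fun x => c (x ∘ Sum.inl) :=
  isPol_base hU hc

/-- The lifted connection is linear in the momenta where weight zero allows it to be, and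
independent of them elsewhere. -/
theorem isWeightZero_liftedConnection {U : Set (Fin n → ℝ)} (hU : IsOpen U)
    {C : Fin n → Fin n → Fin n → (Fin n → ℝ) → ℝ} (hC : ∀ k i j, ContDiffOn ℝ ∞ (C k i j) U) :
    IsWeightZero ((fun x : Phase n => x ∘ Sum.inl) ⁻¹' U) (liftedConnection C) := by
  have hΩ : IsOpen ((fun x : Phase n => x ∘ Sum.inl) ⁻¹' U) := hU.preimage (by fun_prop)
  have hT : ∀ a i j k, ContDiffOn ℝ ∞ (liftTerm C a i j k) U := fun a i j k =>
    (contDiffOn_const.mul (ContDiffOn.sum fun l _ => (hC _ _ _).mul (hC _ _ _))).sub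
      (contDiffOn_partialDeriv hU _ (hC _ _ _))
  rintro (k | k) (i | i) (j | j)
  · exact .of_base hU (hC k i j)
  · exact IsPol.zero hΩ _
  · exact IsPol.zero hΩ _
  · exact IsPol.zero hΩ _
  · have h : HasDegree ((fun x : Phase n => x ∘ Sum.inl) ⁻¹' U) 1
        (∑ a, (fun x : Phase n => x (Sum.inr a)) * fun x => 1 / 3 *
          (liftTerm C a i j k (x ∘ Sum.inl) + liftTerm C a j k i (x ∘ Sum.inl)
            + liftTerm C a k i j (x ∘ Sum.inl))) :=
      IsPol.sum hΩ _ fun a _ => HasDegree.mul hΩ (v := 1) (isPol_momentum a)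
        (.of_base hU (c := fun q => 1 / 3 * (liftTerm C a i j k q + liftTerm C a j k i q
          + liftTerm C a k i j q))
          (contDiffOn_const.mul (((hT _ _ _ _).add (hT _ _ _ _)).add (hT _ _ _ _)))) rfl
    refine IsPol.congr hΩ h fun x _ => ?_
    simp only [liftedConnection, Finset.sum_apply, Pi.mul_apply]
    exact Finset.sum_congr rfl fun a _ => by ring
  · exact .of_base hU (c := fun q => -C j i k q) (hC j i k).neg
  · exact .of_base hU (c := fun q => -C i k j q) (hC i k j).neg
  · exact IsPol.zero hΩ _

/-- Christoffel symbols of a smooth nondegenerate metric are smooth. -/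
theorem contDiffOn_christoffel {U : Set (Fin n → ℝ)} (hU : IsOpen U)
    {G : (Fin n → ℝ) → Matrix (Fin n) (Fin n) ℝ}
    (hG : ∀ i j, ContDiffOn ℝ ∞ (fun q => G q i j) U) (hdet : ∀ q ∈ U, (G q).det ≠ 0)
    (k i j : Fin n) : ContDiffOn ℝ ∞ (christoffel G k i j) U := by
  have hdet_smooth : ∀ {A : (Fin n → ℝ) → Matrix (Fin n) (Fin n) ℝ},
      (∀ i j, ContDiffOn ℝ ∞ (fun q => A q i j) U) → ContDiffOn ℝ ∞ (fun q => (A q).det) U := by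
    intro A hA
    simp only [Matrix.det_apply']
    exact ContDiffOn.sum fun σ _ => contDiffOn_const.mul (contDiffOn_prod fun i _ => hA _ _)
  -- The inverse matrix is the adjugate divided by the determinant.
  have hadj : ∀ k l, ContDiffOn ℝ ∞ (fun q => (G q).adjugate k l) U := by
    intro k l
    simp only [Matrix.adjugate_apply]
    refine hdet_smooth fun a b => ?_
    simp only [Matrix.updateRow_apply]
    split_ifs
    · exact contDiffOn_const
    · exact hG a b
  have hinv : ∀ k l, ContDiffOn ℝ ∞ (fun q => (G q)⁻¹ k l) U := by
    intro k l
    simp only [Matrix.inv_def, Ring.inverse_eq_inv', Matrix.smul_apply, smul_eq_mul]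
    exact ((hdet_smooth hG).inv hdet).mul (hadj k l)
  exact contDiffOn_const.mul (ContDiffOn.sum fun l _ => (hinv k l).mul
    (((contDiffOn_partialDeriv hU _ (hG j l)).add (contDiffOn_partialDeriv hU _ (hG i l))).sub
      (contDiffOn_partialDeriv hU _ (hG i j))))

end Weight

/-! ### Canonical coordinates on the cotangent bundle -/

section Manifold

variable {n : ℕ} {Q : Type*} [TopologicalSpace Q] [ChartedSpace (EuclideanSpace ℝ (Fin n)) Q]
  {φ : OpenPartialHomeomorph Q (EuclideanSpace ℝ (Fin n))}

theorem mdifferentiable_of_mem_maximalAtlas (hφ : φ ∈ IsManifold.maximalAtlas (𝓡 n) ∞ Q) :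
    φ.MDifferentiable (𝓡 n) (𝓡 n) :=
  ⟨(contMDiffOn_of_mem_maximalAtlas hφ).mdifferentiableOn (by simp),
    (contMDiffOn_symm_of_mem_maximalAtlas hφ).mdifferentiableOn (by simp)⟩

variable [IsManifold (𝓡 n) ∞ Q]

theorem contMDiffOn_coordVector (hφ : φ ∈ IsManifold.maximalAtlas (𝓡 n) ∞ Q) (i : Fin n) :
    ContMDiffOn (𝓡 n) ((𝓡 n).prod 𝓘(ℝ, EuclideanSpace ℝ (Fin n))) ∞
      (fun q => Bundle.TotalSpace.mk' (EuclideanSpace ℝ (Fin n))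
        (E := fun x : Q => TangentSpace (𝓡 n) x) (φ.symm q) (coordVector φ q i)) φ.target := by
  intro q hq
  have h := contMDiffAt_symm_of_mem_maximalAtlas hφ hq
  have hd : ContMDiffAt (𝓡 n) 𝓘(ℝ, EuclideanSpace ℝ (Fin n) →L[ℝ] EuclideanSpace ℝ (Fin n)) ∞
      (inTangentCoordinates (𝓡 n) (𝓡 n) id φ.symm (mfderiv (𝓡 n) (𝓡 n) φ.symm) q) q :=
    h.mfderiv_const (by simp)
  have hv : ContMDiffAt (𝓡 n) ((𝓡 n).prod 𝓘(ℝ, EuclideanSpace ℝ (Fin n))) ∞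
      (fun q : EuclideanSpace ℝ (Fin n) => Bundle.TotalSpace.mk' (EuclideanSpace ℝ (Fin n))
        (E := fun x : EuclideanSpace ℝ (Fin n) => TangentSpace (𝓡 n) x) q
        (EuclideanSpace.single i 1 : EuclideanSpace ℝ (Fin n))) q :=
    contMDiffAt_vectorSpace_iff_contDiffAt.2 contDiffAt_const
  exact (ContMDiffAt.clm_apply_of_inCoordinates hd hv h).contMDiffWithinAt

/-- The part of `ℝⁿ` on which the chart `φ` provides coordinates. -/
def coordDomain (φ : OpenPartialHomeomorph Q (EuclideanSpace ℝ (Fin n))) : Set (Fin n → ℝ) :=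
  WithLp.toLp 2 ⁻¹' φ.target

omit [ChartedSpace (EuclideanSpace ℝ (Fin n)) Q] [IsManifold (𝓡 n) ∞ Q] in
theorem isOpen_coordDomain : IsOpen (coordDomain φ) :=
  φ.open_target.preimage (PiLp.continuous_toLp 2 _)

theorem contDiffOn_metricCoeff (g : SemiRiemannianMetric n Q)
    (hφ : φ ∈ IsManifold.maximalAtlas (𝓡 n) ∞ Q) (i j : Fin n) :
    ContDiffOn ℝ ∞ (fun q => metricCoeff g φ q i j) (coordDomain φ) := by
  have h : ContMDiffOn (𝓡 n) 𝓘(ℝ, ℝ) ∞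
      (fun q => g.inner (φ.symm q) (coordVector φ q i) (coordVector φ q j)) φ.target := by
    intro q hq
    have : ContMDiffWithinAt (𝓡 n) ((𝓡 n).prod 𝓘(ℝ)) ∞
        (fun q => Bundle.TotalSpace.mk' ℝ (E := Bundle.Trivial Q ℝ) (φ.symm q)
          (g.inner (φ.symm q) (coordVector φ q i) (coordVector φ q j))) φ.target q := by
      apply ContMDiffWithinAt.clm_bundle_apply₂ (F₁ := EuclideanSpace ℝ (Fin n))
        (F₂ := EuclideanSpace ℝ (Fin n))
      · exact ContMDiffAt.comp_contMDiffWithinAt q g.contMDiff.contMDiffAt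
          (contMDiffOn_symm_of_mem_maximalAtlas hφ q hq)
      · exact contMDiffOn_coordVector hφ i q hq
      · exact contMDiffOn_coordVector hφ j q hq
    simp only [Bundle.contMDiffWithinAt_totalSpace] at this
    exact this.2
  exact (contMDiffOn_iff_contDiffOn.1 h).comp (PiLp.contDiff_toLp (p := 2)).contDiffOn
    fun q hq => hq

theorem det_metricCoeff_ne_zero (g : SemiRiemannianMetric n Q)
    (hφ : φ ∈ IsManifold.maximalAtlas (𝓡 n) ∞ Q) {q : Fin n → ℝ} (hq : q ∈ coordDomain φ) :
    (metricCoeff g φ q).det ≠ 0 := by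
  intro h0
  obtain ⟨v, hv0, hv⟩ := Matrix.exists_vecMul_eq_zero_iff.2 h0
  -- The coordinate vectors are the images of the standard basis under the bijection `L`, so a
  -- linear relation between the rows gives a vector orthogonal to the whole tangent space.
  have hbij := (mdifferentiable_of_mem_maximalAtlas hφ).symm.mfderiv_bijective
    (x := WithLp.toLp 2 q) hq
  set L := mfderiv (𝓡 n) (𝓡 n) φ.symm (WithLp.toLp 2 q)
  have hexp : ∀ w : EuclideanSpace ℝ (Fin n),
      L w = ∑ i, w i • coordVector φ (WithLp.toLp 2 q) i := by
    intro w
    have hw : w = ∑ i, w i • (EuclideanSpace.single i 1 : EuclideanSpace ℝ (Fin n)) := by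
      ext j
      simp [Pi.single_apply]
    conv_lhs => rw [hw]
    exact (map_sum L _ _).trans (Finset.sum_congr rfl fun i _ => map_smul L _ _)
  have hzero : L (WithLp.toLp 2 v) = 0 := by
    refine g.nondegenerate _ _ fun u => ?_
    obtain ⟨w, rfl⟩ := hbij.2 u
    set B := g.inner (φ.symm (WithLp.toLp 2 q))
    have hBv : ∀ j, B (L (WithLp.toLp 2 v)) (coordVector φ (WithLp.toLp 2 q) j) = 0 := by
      intro j
      refine Eq.trans ?_ (congrFun hv j)
      rw [hexp, map_sum]
      refine (sum_apply _ _ _).trans (Finset.sum_congr rfl fun i _ => ?_)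
      rw [map_smul]
      rfl
    refine (congrArg _ (hexp w)).trans ((map_sum _ _ _).trans (Finset.sum_eq_zero fun j _ => ?_))
    rw [map_smul, hBv, smul_zero]
  have : (WithLp.toLp 2 v : EuclideanSpace ℝ (Fin n)) = 0 := hbij.1 (hzero.trans (map_zero L).symm)
  exact hv0 (by simpa using this)

/-- The canonical coordinates are smooth for the bundle structure of `T*Q`. -/
theorem contDiffOn_comp_ofCanonicalCoords (hφ : φ ∈ IsManifold.maximalAtlas (𝓡 n) ∞ Q)
    {f : CotangentBundle n Q → ℂ} (hf : SmoothOnCotangent f) :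
    ContDiffOn ℝ ∞ (f ∘ ofCanonicalCoords φ)
      ((fun x : Phase n => x ∘ Sum.inl) ⁻¹' coordDomain φ) := by
  rw [← contMDiffOn_iff_contDiffOn]
  refine ContMDiff.comp_contMDiffOn hf fun x hx => ContMDiffAt.contMDiffWithinAt ?_
  have hq : ContMDiffAt 𝓘(ℝ, Phase n) (𝓡 n) ∞
      (fun x : Phase n => (WithLp.toLp 2 (x ∘ Sum.inl) : EuclideanSpace ℝ (Fin n))) x := by
    refine ContDiffAt.contMDiffAt ((PiLp.contDiff_toLp (p := 2)).contDiffAt.comp x ?_)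
    exact contDiffAt_pi.2 fun i => contDiffAt_apply ℝ ℝ (Sum.inl i) x
  have hb : ContMDiffAt 𝓘(ℝ, Phase n) (𝓡 n) ∞
      (fun x : Phase n => φ.symm (WithLp.toLp 2 (x ∘ Sum.inl))) x :=
    ContMDiffAt.comp x (contMDiffAt_symm_of_mem_maximalAtlas hφ hx) hq
  rw [contMDiffAt_hom_bundle]
  refine ⟨hb, ?_⟩
  have hd : ContMDiffAt (𝓡 n) 𝓘(ℝ, EuclideanSpace ℝ (Fin n) →L[ℝ] EuclideanSpace ℝ (Fin n)) ∞
      (inTangentCoordinates (𝓡 n) (𝓡 n) id φ (mfderiv (𝓡 n) (𝓡 n) φ)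
        (φ.symm (WithLp.toLp 2 (x ∘ Sum.inl)))) (φ.symm (WithLp.toLp 2 (x ∘ Sum.inl))) :=
    (contMDiffAt_of_mem_maximalAtlas hφ (φ.map_target hx)).mfderiv_const (by simp)
  have hp : ContMDiffAt 𝓘(ℝ, Phase n) 𝓘(ℝ, EuclideanSpace ℝ (Fin n) →L[ℝ] ℝ) ∞
      (fun x : Phase n => (∑ i, x (Sum.inr i) • EuclideanSpace.proj i :
        EuclideanSpace ℝ (Fin n) →L[ℝ] ℝ)) x :=
    ContDiffAt.contMDiffAt (ContDiffAt.sum fun i _ =>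
      (contDiffAt_apply ℝ ℝ (Sum.inr i) x).smul contDiffAt_const)
  -- In the trivialization of `T*Q`, the covector `∑ p_i dq^i` becomes the composition of
  -- `∑ p_i e^i` with the derivative of `φ` in tangent coordinates.
  refine (hp.clm_comp (hd.comp x hb)).congr_of_eventuallyEq (.of_forall fun y => ?_)
  simp only [ContinuousLinearMap.inCoordinates, inTangentCoordinates, Function.comp_apply,
    TangentBundle.continuousLinearMapAt_model_space]
  refine (congrArg (fun L : ℝ →L[ℝ] ℝ => L.comp _)
    (Bundle.Trivial.continuousLinearMapAt_trivialization ℝ Q ℝ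
      (ofCanonicalCoords φ y).proj)).trans ?_
  rfl

theorem totalDegree_bind₁_le_of_linear {σ τ : Type*} {ℓ : σ → MvPolynomial τ ℂ}
    (hℓ : ∀ i, (ℓ i).totalDegree ≤ 1) (P : MvPolynomial σ ℂ) :
    (MvPolynomial.bind₁ ℓ P).totalDegree ≤ P.totalDegree := by
  rw [MvPolynomial.bind₁, MvPolynomial.aeval_def, MvPolynomial.eval₂_eq]
  refine MvPolynomial.totalDegree_finsetSum_le fun m hm => ?_
  refine (MvPolynomial.totalDegree_mul _ _).trans ?_
  rw [MvPolynomial.algebraMap_eq, MvPolynomial.totalDegree_C, zero_add]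
  refine ((MvPolynomial.totalDegree_finsetProd _ _).trans (Finset.sum_le_sum fun i _ => ?_)).trans
    (MvPolynomial.le_totalDegree hm)
  exact (MvPolynomial.totalDegree_pow _ _).trans
    ((Nat.mul_le_mul_left _ (hℓ i)).trans (mul_one _).le)

omit [IsManifold (𝓡 n) ∞ Q] in
/-- The fibre coordinates used to state polynomiality are linear functions of the canonical
momenta, so the degree in the latter is bounded as well. -/
theorem exists_polynomial_comp_ofCanonicalCoords {N : ℕ} {f : CotangentBundle n Q → ℂ}
    (hf : IsMomentumPolynomial N f) (q : Fin n → ℝ) :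
    ∃ P : MvPolynomial (Fin n) ℂ, P.totalDegree ≤ N ∧ ∀ p : Fin n → ℝ,
      (f ∘ ofCanonicalCoords φ) (Sum.elim q p) = MvPolynomial.eval (fun i => (p i : ℂ)) P := by
  obtain ⟨P, hP, hfP⟩ := hf (φ.symm (WithLp.toLp 2 q))
  let e : Fin n → EuclideanSpace ℝ (Fin n) := fun i =>
    mfderiv (𝓡 n) (𝓡 n) φ (φ.symm (WithLp.toLp 2 q))
      (EuclideanSpace.single i 1 : EuclideanSpace ℝ (Fin n))
  let ℓ : Fin n → MvPolynomial (Fin n) ℂ := fun i =>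
    ∑ j, MvPolynomial.C (e i j : ℂ) * MvPolynomial.X j
  have hℓ : ∀ i, (ℓ i).totalDegree ≤ 1 := fun i =>
    MvPolynomial.totalDegree_finsetSum_le fun j _ =>
      (MvPolynomial.totalDegree_mul _ _).trans (by simp)
  refine ⟨MvPolynomial.bind₁ ℓ P, ?_, fun p => ?_⟩
  · exact (totalDegree_bind₁_le_of_linear hℓ P).trans hP
  · refine (hfP _).trans ?_
    refine Eq.trans ?_ (MvPolynomial.eval₂Hom_bind₁ (RingHom.id ℂ) _ ℓ P).symm
    refine congrArg (fun v => MvPolynomial.eval v P) (funext fun i => ?_)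
    have h : ((∑ j, p j • EuclideanSpace.proj j : EuclideanSpace ℝ (Fin n) →L[ℝ] ℝ) (e i))
        = ∑ j, p j * e i j := by
      simp
    refine (congrArg Complex.ofReal h).trans ?_
    simp [ℓ, mul_comm]

theorem hasDegree_comp_ofCanonicalCoords (hφ : φ ∈ IsManifold.maximalAtlas (𝓡 n) ∞ Q) {N : ℕ}
    {f : CotangentBundle n Q → ℂ} (hf : SmoothOnCotangent f) (hfN : IsMomentumPolynomial N f) :
    HasDegree ((fun x : Phase n => x ∘ Sum.inl) ⁻¹' coordDomain φ) N
      (f ∘ ofCanonicalCoords φ) :=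
  isPol_of_fiberwise isOpen_coordDomain N (contDiffOn_comp_ofCanonicalCoords hφ hf)
    fun q _ => exists_polynomial_comp_ofCanonicalCoords hfN q

theorem coeff_chartStar_eq_zero (g : SemiRiemannianMetric n Q) {N M : ℕ}
    {f h : CotangentBundle n Q → ℂ} (hf : SmoothOnCotangent f) (hh : SmoothOnCotangent h)
    (hfN : IsMomentumPolynomial N f) (hhM : IsMomentumPolynomial M h)
    (hφ : φ ∈ IsManifold.maximalAtlas (𝓡 n) ∞ Q) {m : CotangentBundle n Q}
    (hm : m.proj ∈ φ.source) {k : ℕ} (hk : N + M < k) :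
    PowerSeries.coeff k (chartStar g φ f h) m = 0 := by
  unfold chartStar
  rw [PowerSeries.coeff_mk]
  refine coeff_coordStar_eq_zero (isOpen_coordDomain.preimage (by fun_prop))
    (isWeightZero_liftedConnection isOpen_coordDomain fun k i j =>
      contDiffOn_christoffel isOpen_coordDomain (contDiffOn_metricCoeff g hφ)
        (fun q hq => det_metricCoeff_ne_zero g hφ hq) k i j)
    (hasDegree_comp_ofCanonicalCoords hφ hf hfN) (hasDegree_comp_ofCanonicalCoords hφ hh hhM)
    hk ?_
  exact φ.map_source hm

end Manifold
end Fedosov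

end


theorem mainTheorem3 {n : ℕ} {Q : Type*} [TopologicalSpace Q]
    [ChartedSpace (EuclideanSpace ℝ (Fin n)) Q] [IsManifold (𝓡 n) ∞ Q]
    (g : Fedosov.SemiRiemannianMetric n Q) (N M : ℕ) (f h : Fedosov.CotangentBundle n Q → ℂ)
    (hf : Fedosov.SmoothOnCotangent f) (hh : Fedosov.SmoothOnCotangent h)
    (hfN : Fedosov.IsMomentumPolynomial N f) (hhM : Fedosov.IsMomentumPolynomial M h) :
    (∃ P : Polynomial (Fedosov.CotangentBundle n Q → ℂ),
      P.natDegree ≤ N + M ∧ (P : PowerSeries _) = Fedosov.fedosovStar g f h) ∧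
    ∀ φ ∈ IsManifold.maximalAtlas (𝓡 n) ∞ Q, ∀ m : Fedosov.CotangentBundle n Q,
      m.proj ∈ φ.source → ∀ k > N + M,
        PowerSeries.coeff k (Fedosov.chartStar g φ f h) m = 0 := by
  refine ⟨⟨PowerSeries.trunc (N + M + 1) (Fedosov.fedosovStar g f h), ?_, ?_⟩, ?_⟩
  · exact Nat.lt_succ_iff.1 (PowerSeries.natDegree_trunc_lt _ _)
  · ext k : 1
    rw [Polynomial.coeff_coe, PowerSeries.coeff_trunc]
    split_ifs with hk
    · rfl
    · funext m
      unfold Fedosov.fedosovStar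
      rw [PowerSeries.coeff_mk]
      exact (Fedosov.coeff_chartStar_eq_zero g hf hh hfN hhM
        (IsManifold.chart_mem_maximalAtlas m.proj) (mem_chart_source _ _) (by omega)).symm
  · exact fun φ hφ m hm k hk => Fedosov.coeff_chartStar_eq_zero g hf hh hfN hhM hφ hm hk
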